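/- Let $(R,\mathfrak m)$ be a Noetherian local ring, let $a_1,a_2$ be an $R$-sequence and let $p\ge 2$. Set $x_1=a_1^p$, $x_2=a_2^p$, $y=a_1a_2^{p-1}$, $I=(x_1,x_2,y)$ and $J=(x_1,x_2)$. Let $V=R[X_1,X_2,Y]$ with its standard grading, and let $Q$ be the kernel of the $R$-algebra map $\varphi:V\to R[It]=\bigoplus_{n\ge0}I^nt^n$ onto the Rees algebra with $\varphi(X_1)=x_1t$, $\varphi(X_2)=x_2t$, $\varphi(Y)=yt$. Then $x_1,x_2,y$ is a minimal generating set of $I$, and the ideal $Q$ is minimally generated (that is, it is generated, and no generator can be omitted) by the $p+1$ forms consisting of the two linear forms $$F_1=a_1^{p-1}Y-a_2^{p-1}X_1,\qquad G_1=a_2Y-a_1X_2,$$ together with exactly one form $$F_n=a_1^{p-n}Y^n-a_2^{p-n}X_1X_2^{n-1}$$ of degree $n$ for each $2\le n\le p$. Moreover $\mathrm{rt}(I)=\mathrm r_J(I)+1=p$. Here $\mathrm r_J(I)$ is the least integer $r\ge0$ with $I^{r+1}=JI^r$. The relation type $\mathrm{rt}(I)$ is the least integer $N\ge1$ such that the kernel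 $Q_z$ of the presentation $R[T_1,\dots,T_m]\to R[It]$, $T_i\mapsto z_it$, given by a minimal generating set $z_1,\dots,z_m$ of $I$ is generated by its homogeneous elements of degree at most $N$; this least integer is the same for every minimal generating set of $I$. -/

import Mathlib

/-- The family `g` minimally generates the submodule `N`: it generates `N`, and no member of
the family can be left out. -/
def IsMinimalGeneratingFamily {A M ι : Type*} [Semiring A] [AddCommMonoid M] [Module A M]
    (g : ι → M) (N : Submodule A M) : Prop :=
  Submodule.span A (Set.range g) = N ∧ ∀ i, Submodule.span A (g '' {j | j ≠ i}) ≠ N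

section Rees

/-- For a tuple `z` of elements of `R`, generating the ideal `I`, the presentation
`R[T₁, …, Tₘ] → R[It]` of the Rees algebra of `I` that sends `Tᵢ` to `zᵢ t`. -/
noncomputable def reesPresentation {R : Type*} [CommRing R] {m : ℕ} (z : Fin m → R) :
    MvPolynomial (Fin m) R →ₐ[R] reesAlgebra (Ideal.span (Set.range z)) :=
  MvPolynomial.aeval fun i =>
    ⟨Polynomial.monomial 1 (z i),
      reesAlgebra.monomial_mem.2
        (by simpa using Ideal.subset_span (Set.mem_range_self i))⟩

/-- The ideal `Q` of equations of the Rees algebra, with respect to the generators `z`. -/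
noncomputable def reesEquations {R : Type*} [CommRing R] {m : ℕ} (z : Fin m → R) :
    Ideal (MvPolynomial (Fin m) R) :=
  RingHom.ker (reesPresentation z)

/-- The ideal `Q⟨n⟩` generated by the homogeneous equations of degree at most `n`. -/
noncomputable def reesEquationsUpTo {R : Type*} [CommRing R] {m : ℕ} (z : Fin m → R) (n : ℕ) :
    Ideal (MvPolynomial (Fin m) R) :=
  Ideal.span {F | F ∈ reesEquations z ∧ ∃ d ≤ n, F.IsHomogeneous d}

/-- `N` is the relation type of the finitely generated ideal `I`: for every minimal generating
tuple of `I`, `N` is the least integer `N ≥ 1` with `Q = Q⟨N⟩`. -/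
def IsRelationType {R : Type*} [CommRing R] (I : Ideal R) (N : ℕ) : Prop :=
  I.FG ∧ ∀ (m : ℕ) (z : Fin m → R), IsMinimalGeneratingFamily z I →
    IsLeast {k : ℕ | 1 ≤ k ∧ reesEquations z = reesEquationsUpTo z k} N

/-- `r` is the reduction number of `I` with respect to `J`. -/
def IsReductionNumber {R : Type*} [CommRing R] (J I : Ideal R) (r : ℕ) : Prop :=
  J ≤ I ∧ IsLeast {k : ℕ | I ^ (k + 1) = J * I ^ k} r

end Rees

section Forms

/-! In `R[X₁, X₂, Y]` the variables `X₁`, `X₂`, `Y` are `X 0`, `X 1`, `X 2`. -/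

/-- The form `Fₙ = a₁^(p-n) Y^n - a₂^(p-n) X₁ X₂^(n-1)`, used for `1 ≤ n ≤ p`; in particular
`F₁ = a₁^(p-1) Y - a₂^(p-1) X₁`. -/
noncomputable def formF {R : Type*} [CommRing R] (a₁ a₂ : R) (p n : ℕ) :
    MvPolynomial (Fin 3) R :=
  MvPolynomial.C (a₁ ^ (p - n)) * MvPolynomial.X 2 ^ n -
    MvPolynomial.C (a₂ ^ (p - n)) * MvPolynomial.X 0 * MvPolynomial.X 1 ^ (n - 1)

/-- The linear form `G₁ = a₂ Y - a₁ X₂`. -/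
noncomputable def formG {R : Type*} [CommRing R] (a₁ a₂ : R) : MvPolynomial (Fin 3) R :=
  MvPolynomial.C a₂ * MvPolynomial.X 2 - MvPolynomial.C a₁ * MvPolynomial.X 1

/-- The family `G₁, F₁, F₂, …, Fₚ`. -/
noncomputable def formFamily {R : Type*} [CommRing R] (a₁ a₂ : R) (p : ℕ) :
    Fin (p + 1) → MvPolynomial (Fin 3) R :=
  Fin.cons (formG a₁ a₂) fun i : Fin p => formF a₁ a₂ p (i + 1)

end Forms

/-! Write `a`, `b` for `a₁`, `a₂`. A monomial `X₁^i X₂^j Y^k` of degree `n` takes the value `a^e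
b^(pn-e)` with `e = pi + k`, so an equation of degree `n` is a relation among such products. Modulo
`Fₚ = Y^p - X₁X₂^(p-1)` only one monomial per exponent `e` survives, the one with `k < p`. Since
`a`, `b` is regular in either order, relations among the products `a^e b^(N-e)` come from
neighbouring exponents (`sum_smul_mem_of_sum_mul_pow_eq_zero`). Neighbours `e`, `e + 1` with the
same quotient by `p` give multiples of `G₁`; the jump to the next multiple of `p` gives a multiple
of some `Fₖ` with `k < p` (`normalMonomial_relation_mem`). Hence the listed forms generate `Q`.

The lower bounds use the specialization `X₁, X₂ ↦ 0`, under which `G₁ ↦ bY` and `Fₙ ↦ a^(p-n) Y^n`.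
It shows that no `Fₙ` is redundant, and that below degree `p` the pure `Y`-coefficient of an
equation lies in `(a, b)`, while in `Fₚ` it is `1`. So generators of degree `p` are needed. Likewise
`I^(r+1) = J I^r` would give an equation of degree `r + 1` monic in `Y`, forcing `r + 1 ≥ p`;
conversely `y^p = x₁x₂^(p-1)` gives equality for `r = p - 1`. -/

/-! ### Divisibility and monomial syzygies for a regular pair. -/

section RegularPair

variable {R : Type*} [CommRing R]

/-- In a pair of elements forming a regular sequence, the second is regular modulo the first. -/
theorem RingTheory.Sequence.IsWeaklyRegular.dvd_of_dvd_mul_pair {a b : R}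
    (h : RingTheory.Sequence.IsWeaklyRegular R [a, b]) {c : R} (hc : a ∣ b * c) : a ∣ c := by
  rw [RingTheory.Sequence.isWeaklyRegular_cons_iff,
    RingTheory.Sequence.isWeaklyRegular_singleton_iff] at h
  have := mem_of_isSMulRegular_quotient_of_smul_mem (x := c) h.2 (by
    rw [Submodule.mem_smul_pointwise_iff_exists]
    obtain ⟨d, hd⟩ := hc
    exact ⟨d, trivial, by simp [hd]⟩)
  rw [Submodule.mem_smul_pointwise_iff_exists] at this
  obtain ⟨d, -, hd⟩ := this
  exact ⟨d, by simpa using hd.symm⟩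

theorem RingTheory.Sequence.IsWeaklyRegular.isLeftRegular_head {a : R} {l : List R}
    (h : RingTheory.Sequence.IsWeaklyRegular R (a :: l)) : IsLeftRegular a := by
  rw [RingTheory.Sequence.isWeaklyRegular_cons_iff] at h
  intro x y hxy
  exact h.1 hxy

/-- Factors of `b` are stripped off one at a time: `a` is regular modulo `b`, and `b` itself
cancels. -/
theorem pow_dvd_of_pow_dvd_mul {a b : R} (hb : IsLeftRegular b) (hab : ∀ c, b ∣ a * c → b ∣ c)
    (m : ℕ) : ∀ (n : ℕ) (c : R), b ^ n ∣ a ^ m * c → b ^ n ∣ c := by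
  have one : ∀ (n : ℕ) (c : R), b ^ n ∣ a * c → b ^ n ∣ c := by
    intro n
    induction n with
    | zero => simp
    | succ n ih =>
      rintro c ⟨r, hr⟩
      obtain ⟨d, rfl⟩ := hab c ⟨b ^ n * r, by rw [hr]; ring⟩
      rw [pow_succ']
      exact mul_dvd_mul_left b (ih d ⟨r, hb (by
        show b * (a * d) = b * (b ^ n * r)
        linear_combination hr)⟩)
  induction m with
  | zero => simp
  | succ m ih =>
    intro n c hc
    refine one n c (ih n _ ?_)
    rwa [← mul_assoc, ← pow_succ]

/-- Syzygies of the monomials `a ^ e * b ^ (N - e)`, for `e` in a finite set of exponents, are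
generated by those between neighbours. -/
theorem sum_smul_mem_of_sum_mul_pow_eq_zero {M : Type*} [AddCommGroup M] [Module R M]
    {a b : R} (ha : IsLeftRegular a) (hb : IsLeftRegular b) (hab : ∀ c, b ∣ a * c → b ∣ c)
    (K : Submodule R M) (T : ℕ → M) (N : ℕ) (E : Finset ℕ) (hN : ∀ e ∈ E, e ≤ N)
    (hT : ∀ m ∈ E, ∀ e ∈ E, e < m → (∀ e' ∈ E, e' < m → e' ≤ e) →
      a ^ (m - e) • T e - b ^ (m - e) • T m ∈ K)
    (c : ℕ → R) (hc : ∑ e ∈ E, c e * (a ^ e * b ^ (N - e)) = 0) :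
    ∑ e ∈ E, c e • T e ∈ K := by
  induction E using Finset.induction_on_max generalizing c with
  | empty => simp
  | insert m s hm ih =>
    have hms : m ∉ s := fun h => lt_irrefl _ (hm m h)
    have hmN : m ≤ N := hN m (Finset.mem_insert_self _ _)
    rw [Finset.sum_insert hms] at hc ⊢
    -- As `m` is the largest exponent, every term carries the factor `b ^ (N - m)`, which cancels.
    have hcancel : c m * a ^ m + ∑ e ∈ s, c e * (a ^ e * b ^ (m - e)) = 0 := by
      refine (hb.pow (N - m)) ?_
      simp only [mul_zero]
      rw [← hc, mul_add, Finset.mul_sum]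
      congr 1
      · ring
      · refine Finset.sum_congr rfl fun e he => ?_
        have : N - e = (N - m) + (m - e) := by have := hm e he; omega
        rw [this, pow_add]; ring
    rcases s.eq_empty_or_nonempty with rfl | hs
    · have : c m = 0 := (ha.pow m) (by simpa [mul_comm] using hcancel)
      simp [this]
    · set e₀ := s.max' hs with he₀
      have he₀s : e₀ ∈ s := s.max'_mem hs
      have hlt : e₀ < m := hm _ he₀s
      have hle : ∀ e ∈ s, e ≤ e₀ := fun e he => s.le_max' e he
      -- All terms other than that of `m` have exponent at most `e₀`, hence are divisible by `b ^ (m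
      -- - e₀)`.
      have hdvd : b ^ (m - e₀) ∣ c m := by
        refine pow_dvd_of_pow_dvd_mul hb hab m _ _ ?_
        rw [mul_comm, eq_neg_of_add_eq_zero_left hcancel, dvd_neg]
        refine Finset.dvd_sum fun e he => ?_
        refine dvd_mul_of_dvd_right (dvd_mul_of_dvd_right (pow_dvd_pow _ ?_) _) _
        have := hle e he
        omega
      obtain ⟨d, hd⟩ := hdvd
      have hrel := hT m (Finset.mem_insert_self _ _) e₀ (Finset.mem_insert_of_mem he₀s) hlt
        (fun e' he' hlt' => by
          rcases Finset.mem_insert.1 he' with rfl | h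
          · exact absurd hlt' (lt_irrefl _)
          · exact hle _ h)
      -- Writing `c m = b ^ (m - e₀) * d`, the neighbour relation moves the coefficient of `m` onto
      -- `e₀`, leaving a relation supported on `s`.
      have key := ih (fun e he => hN e (Finset.mem_insert_of_mem he))
        (fun m' hm' e he hlt' hmax => hT m' (Finset.mem_insert_of_mem hm') e
          (Finset.mem_insert_of_mem he) hlt' (fun e' he' hlt'' => by
            rcases Finset.mem_insert.1 he' with rfl | h
            · exact absurd (hm m' hm') (not_lt.2 hlt''.le)
            · exact hmax _ h hlt''))
        (fun e => c e + if e = e₀ then d * a ^ (m - e₀) else 0) (by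
          simp only [add_mul, Finset.sum_add_distrib, ite_mul, zero_mul,
            Finset.sum_ite_eq', he₀s, if_true]
          rw [← hc, add_comm]
          congr 1
          have h1 : N - e₀ = (N - m) + (m - e₀) := by omega
          have h2 : a ^ m = a ^ (m - e₀) * a ^ e₀ := by rw [← pow_add]; congr 1; omega
          rw [h1, pow_add, hd, h2]; ring)
      simp only [add_smul, Finset.sum_add_distrib, ite_smul, zero_smul,
            Finset.sum_ite_eq', he₀s, if_true] at key
      have := K.sub_mem key (K.smul_mem d hrel)
      rw [hd]
      convert this using 1
      rw [smul_sub, smul_smul, smul_smul, mul_comm d (b ^ _)]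
      abel

end RegularPair

/-! ### Equations of Rees algebras and independence of generators. -/

section Equations

open MvPolynomial

variable {R : Type*} [CommRing R] {m : ℕ} (z : Fin m → R)

/-- The Rees algebra is a subalgebra of `R[t]`, so vanishing can be tested there. -/
theorem mem_reesEquations_iff_aeval (F : MvPolynomial (Fin m) R) :
    F ∈ reesEquations z ↔ aeval (fun i => Polynomial.monomial 1 (z i)) F = 0 := by
  have h : ((reesAlgebra (Ideal.span (Set.range z))).val).comp (reesPresentation z) =
      aeval (fun i => Polynomial.monomial 1 (z i)) := by
    ext i
    simp [reesPresentation]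
  rw [← h, reesEquations, RingHom.mem_ker]
  simp

theorem coeff_aeval_monomial_one (F : MvPolynomial (Fin m) R) (n : ℕ) :
    (aeval (fun i => Polynomial.monomial 1 (z i)) F).coeff n =
      eval z (homogeneousComponent n F) := by
  induction F using MvPolynomial.induction_on' with
  | add p q hp hq => simp [hp, hq]
  | monomial d c =>
    have h : (aeval (fun i => Polynomial.monomial 1 (z i)) (monomial d c)) =
        Polynomial.monomial d.degree (eval z (monomial d c)) := by
      simp only [aeval_monomial, eval_monomial, Finsupp.prod, ← Polynomial.C_mul_X_pow_eq_monomial,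
        Polynomial.algebraMap_eq, pow_one, mul_pow, Finset.prod_mul_distrib,
        Finset.prod_pow_eq_pow_sum, map_mul, map_prod, map_pow, mul_assoc, Finsupp.degree_apply]
    rw [h, Polynomial.coeff_monomial,
      homogeneousComponent_of_mem (isHomogeneous_monomial (n := d.degree) c rfl)]
    by_cases hd : d.degree = n
    · rw [if_pos hd, if_pos hd.symm]
    · rw [if_neg hd, if_neg (Ne.symm hd), map_zero]

theorem mem_reesEquations_iff (F : MvPolynomial (Fin m) R) :
    F ∈ reesEquations z ↔ ∀ n, eval z (homogeneousComponent n F) = 0 := by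
  rw [mem_reesEquations_iff_aeval, Polynomial.ext_iff]
  simp only [coeff_aeval_monomial_one, Polynomial.coeff_zero]

theorem MvPolynomial.IsHomogeneous.mem_reesEquations_iff {F : MvPolynomial (Fin m) R} {n : ℕ}
    (hF : F.IsHomogeneous n) : F ∈ reesEquations z ↔ eval z F = 0 := by
  rw [_root_.mem_reesEquations_iff]
  refine ⟨fun h => ?_, fun h k => ?_⟩
  · simpa [homogeneousComponent_of_mem hF] using h n
  · rw [homogeneousComponent_of_mem hF]
    split_ifs <;> simp [h]

/-- Homogeneous polynomials suffice to test whether an ideal contains all equations. -/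
theorem reesEquations_le_of_homogeneous (K : Ideal (MvPolynomial (Fin m) R))
    (h : ∀ n F, F.IsHomogeneous n → eval z F = 0 → F ∈ K) : reesEquations z ≤ K := by
  intro F hF
  rw [mem_reesEquations_iff] at hF
  rw [← sum_homogeneousComponent F]
  exact K.sum_mem fun n _ => h n _ (homogeneousComponent_isHomogeneous n F) (hF n)

theorem reesEquationsUpTo_le (n : ℕ) : reesEquationsUpTo z n ≤ reesEquations z :=
  Ideal.span_le.2 fun _ hF => hF.1

/-- Whether the equations are generated in degrees at most `n`, for `n ≥ 1`, does not depend on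
the generators of the ideal. -/
theorem reesEquations_eq_upTo_of_span_eq {k : ℕ} (w : Fin k → R)
    (hzw : Ideal.span (Set.range z) = Ideal.span (Set.range w)) {n : ℕ} (hn : 1 ≤ n)
    (hw : reesEquations w = reesEquationsUpTo w n) :
    reesEquations z = reesEquationsUpTo z n := by
  refine le_antisymm ?_ (reesEquationsUpTo_le z n)
  have hA : ∀ i, ∃ F : MvPolynomial (Fin k) R, F.IsHomogeneous 1 ∧ eval w F = z i := fun i => by
    rw [← Ideal.mem_span_pow_iff_exists_isHomogeneous, pow_one, ← hzw]
    exact Ideal.subset_span ⟨i, rfl⟩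
  have hB : ∀ j, ∃ F : MvPolynomial (Fin m) R, F.IsHomogeneous 1 ∧ eval z F = w j := fun j => by
    rw [← Ideal.mem_span_pow_iff_exists_isHomogeneous, pow_one, hzw]
    exact Ideal.subset_span ⟨j, rfl⟩
  choose A hA1 hA2 using hA
  choose B hB1 hB2 using hB
  have evA : ∀ F, eval w (aeval A F) = eval z F := fun F => by
    have : ((aeval w).comp (aeval A) : MvPolynomial (Fin m) R →ₐ[R] R) = aeval z := by
      ext i
      simp [hA2]
    simpa using congr($this F)
  have evB : ∀ F, eval z (aeval B F) = eval w F := fun F => by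
    have : ((aeval z).comp (aeval B) : MvPolynomial (Fin k) R →ₐ[R] R) = aeval w := by
      ext i
      simp [hB2]
    simpa using congr($this F)
  have hmap : ∀ F ∈ reesEquationsUpTo w n, aeval B F ∈ reesEquationsUpTo z n := by
    intro F hF
    have : reesEquationsUpTo w n ≤ (reesEquationsUpTo z n).comap (aeval B) := by
      refine Ideal.span_le.2 ?_
      rintro G ⟨hG, d, hd, hGd⟩
      have hBG : (aeval B G).IsHomogeneous d := by simpa using hGd.aeval B hB1
      refine Ideal.subset_span ⟨(hBG.mem_reesEquations_iff z).2 ?_, d, hd, hBG⟩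
      rw [evB]
      exact (hGd.mem_reesEquations_iff w).1 hG
    exact this hF
  -- Each `X i - aeval B (A i)` is a linear equation, so the round trip is the identity modulo
  -- equations of degree 1; this is where `1 ≤ n` enters.
  have hdiff : ∀ F, F - aeval B (aeval A F) ∈ reesEquationsUpTo z n := by
    intro F
    rw [← Ideal.Quotient.mk_eq_mk_iff_sub_mem]
    have : (Ideal.Quotient.mkₐ R (reesEquationsUpTo z n)) =
        ((Ideal.Quotient.mkₐ R (reesEquationsUpTo z n)).comp (aeval B)).comp (aeval A) := by
      ext i
      simp only [AlgHom.comp_apply, aeval_X, Ideal.Quotient.mkₐ_eq_mk]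
      rw [Ideal.Quotient.mk_eq_mk_iff_sub_mem]
      have hBA : (aeval B (A i)).IsHomogeneous 1 := by simpa using (hA1 i).aeval B hB1
      have hX := (isHomogeneous_X R i).sub hBA
      refine Ideal.subset_span ⟨(hX.mem_reesEquations_iff z).2 ?_, 1, hn, hX⟩
      rw [map_sub, evB, hA2, eval_X, sub_self]
    simpa using congr($this F)
  refine fun F hF => ?_
  rw [← sub_add_cancel F (aeval B (aeval A F))]
  refine Ideal.add_mem _ (hdiff F) (hmap _ ?_)
  rw [← hw]
  have := reesEquations_le_of_homogeneous z ((reesEquations w).comap (aeval A)) (by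
    intro d G hG h0
    have hAG : (aeval A G).IsHomogeneous d := by simpa using hG.aeval A hA1
    refine (hAG.mem_reesEquations_iff w).2 ?_
    rw [evA, h0])
  exact this hF

theorem isRelationType_span_range (n : ℕ)
    (h : IsLeast {k : ℕ | 1 ≤ k ∧ reesEquations z = reesEquationsUpTo z k} n) :
    IsRelationType (Ideal.span (Set.range z)) n := by
  refine ⟨⟨(Set.finite_range z).toFinset, by simp⟩, fun k w hw => ?_⟩
  have hwz : Ideal.span (Set.range w) = Ideal.span (Set.range z) := hw.1
  convert h using 1
  ext l
  exact and_congr_right fun hl =>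
    ⟨reesEquations_eq_upTo_of_span_eq z w hwz.symm hl, reesEquations_eq_upTo_of_span_eq w z hwz hl⟩

end Equations

/-! ### The listed forms generate the equations. -/

section Forms

open MvPolynomial

variable {R : Type*} [CommRing R]

theorem formG_isHomogeneous (a b : R) : (formG a b).IsHomogeneous 1 :=
  ((isHomogeneous_X R 2).C_mul b).sub ((isHomogeneous_X R 1).C_mul a)

theorem formF_isHomogeneous (a b : R) (p : ℕ) {n : ℕ} (hn : 1 ≤ n) :
    (formF a b p n).IsHomogeneous n := by
  refine ((isHomogeneous_X_pow 2 n).C_mul _).sub ?_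
  have := ((isHomogeneous_X R (0 : Fin 3)).C_mul (b ^ (p - n))).mul
    (isHomogeneous_X_pow (R := R) (1 : Fin 3) (n - 1))
  rwa [Nat.add_sub_cancel' hn] at this

theorem eval_formG (a b : R) {p : ℕ} (hp : 1 ≤ p) :
    eval ![a ^ p, b ^ p, a * b ^ (p - 1)] (formG a b) = 0 := by
  obtain ⟨q, rfl⟩ := Nat.exists_eq_add_of_le' hp
  simp [formG]
  ring

theorem eval_formF (a b : R) {p n : ℕ} (hn : 1 ≤ n) (hnp : n ≤ p) :
    eval ![a ^ p, b ^ p, a * b ^ (p - 1)] (formF a b p n) = 0 := by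
  obtain ⟨k, rfl⟩ := Nat.exists_eq_add_of_le' hn
  obtain ⟨l, rfl⟩ := Nat.exists_eq_add_of_le hnp
  have h1 : k + 1 + l - (k + 1) = l := by omega
  have h2 : k + 1 + l - 1 = k + l := by omega
  simp [formF, h1, h2]
  ring

theorem span_formFamily (a b : R) (p : ℕ) :
    Ideal.span (Set.range (formFamily a b p)) =
      Ideal.span {formG a b} ⊔ Ideal.span {F | ∃ n, 1 ≤ n ∧ n ≤ p ∧ F = formF a b p n} := by
  rw [formFamily, Fin.range_cons, Ideal.span_insert]
  congr 2
  ext F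
  constructor
  · rintro ⟨i, rfl⟩
    exact ⟨i + 1, by omega, i.2, rfl⟩
  · rintro ⟨n, h1, h2, rfl⟩
    exact ⟨⟨n - 1, by omega⟩, by simp [Nat.sub_add_cancel h1]⟩

theorem formG_mem_span (a b : R) (p : ℕ) :
    formG a b ∈ Ideal.span (Set.range (formFamily a b p)) :=
  Ideal.subset_span ⟨0, rfl⟩

theorem formF_mem_span (a b : R) {p n : ℕ} (hn : 1 ≤ n) (hnp : n ≤ p) :
    formF a b p n ∈ Ideal.span (Set.range (formFamily a b p)) := by
  rw [span_formFamily]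
  exact Ideal.mem_sup_right (Ideal.subset_span ⟨n, hn, hnp, rfl⟩)

/-- The monomial of degree `n` with `Y`-exponent below `p` on which `X₁ ↦ a ^ p`, `X₂ ↦ b ^ p`,
`Y ↦ a * b ^ (p - 1)` takes the value `a ^ e * b ^ (p * n - e)`. -/
noncomputable def normalMonomial (R : Type*) [CommRing R] (p n e : ℕ) : MvPolynomial (Fin 3) R :=
  X 0 ^ (e / p) * X 1 ^ (n - e / p - e % p) * X 2 ^ (e % p)

theorem normalMonomial_mul_add {p k : ℕ} (hk : k < p) (n i : ℕ) :
    normalMonomial R p n (p * i + k) = X 0 ^ i * X 1 ^ (n - i - k) * X 2 ^ k := by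
  rw [normalMonomial, Nat.mul_add_div (by omega), Nat.mul_add_mod, Nat.div_eq_of_lt hk,
    Nat.mod_eq_of_lt hk, add_zero]

/-- Replacing `Y^p` by `X₁X₂^(p-1)` by means of `Fₚ` preserves both the degree and `p * i + k`, and
lowers the `Y`-exponent. -/
theorem monomial_sub_normalMonomial_mem (a b : R) {p : ℕ} (hp : 1 ≤ p) (i j k : ℕ) :
    X 0 ^ i * X 1 ^ j * X 2 ^ k - normalMonomial R p (i + j + k) (p * i + k) ∈
      Ideal.span (Set.range (formFamily a b p)) := by
  induction k using Nat.strong_induction_on generalizing i j with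
  | _ k ih =>
    rcases lt_or_ge k p with hk | hk
    · have : i + j + k - i - k = j := by omega
      rw [normalMonomial_mul_add hk, this, sub_self]
      exact zero_mem _
    · obtain ⟨l, rfl⟩ := Nat.exists_eq_add_of_le hk
      have h := ih l (by omega) (i + 1) (j + (p - 1))
      have e1 : i + 1 + (j + (p - 1)) + l = i + j + (p + l) := by omega
      have e2 : p * (i + 1) + l = p * i + (p + l) := by ring
      rw [e1, e2] at h
      have hF := Ideal.mul_mem_left _ (X 0 ^ i * X 1 ^ j * X 2 ^ l)
        (formF_mem_span a b hp le_rfl)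
      convert Ideal.add_mem _ h hF using 1
      simp only [formF, Nat.sub_self, pow_zero, C_1, one_mul]
      ring

theorem normalMonomial_relation_mem (a b : R) {p : ℕ} (hp : 2 ≤ p) {n e m : ℕ}
    (he : e / p + e % p ≤ n) (hm : m / p + m % p ≤ n) (hem : e < m)
    (hmax : ∀ e', e' / p + e' % p ≤ n → e' < m → e' ≤ e) :
    a ^ (m - e) • normalMonomial R p n e - b ^ (m - e) • normalMonomial R p n m ∈
      Ideal.span (Set.range (formFamily a b p)) := by
  have hp0 : 0 < p := by omega
  obtain ⟨i, k, hk, rfl⟩ : ∃ i k, k < p ∧ m = p * i + k :=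
    ⟨m / p, m % p, Nat.mod_lt _ hp0, (Nat.div_add_mod m p).symm⟩
  have hdiv : ∀ i k, k < p → (p * i + k) / p = i := fun i k hk => by
    rw [Nat.mul_add_div hp0, Nat.div_eq_of_lt hk, add_zero]
  have hmod : ∀ i k, k < p → (p * i + k) % p = k := fun i k hk => by
    rw [Nat.mul_add_mod, Nat.mod_eq_of_lt hk]
  rw [hdiv i k hk, hmod i k hk] at hm
  rcases k with _ | k
  · rcases i with _ | i
    · simp at hem
    · have hlt : p * i + p = p * (i + 1) := by ring
      -- The predecessor of `p * (i + 1)` has quotient `i` and the largest remainder allowed by `p`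
      -- and the degree. It is at least 1, so the corresponding `Fₖ` exists.
      have hmin : min (p - 1) (n - i) < p := by omega
      have h0 := hmax (p * i + min (p - 1) (n - i))
        (by rw [hdiv _ _ hmin, hmod _ _ hmin]; omega) (by omega)
      have hei : e / p = i := by
        refine le_antisymm ?_ ((Nat.le_div_iff_mul_le hp0).2 (by rw [mul_comm]; omega))
        exact Nat.lt_succ_iff.1 ((Nat.div_lt_iff_lt_mul hp0).2 (by rw [mul_comm]; exact hem))
      obtain ⟨k, hk, rfl⟩ : ∃ k, k < p ∧ e = p * i + k :=
        ⟨e % p, Nat.mod_lt _ hp0, by rw [← hei]; exact (Nat.div_add_mod e p).symm⟩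
      rw [hdiv _ _ hk, hmod _ _ hk] at he
      have hk1 : 1 ≤ k := by omega
      obtain ⟨j, rfl⟩ := Nat.exists_eq_add_of_le he
      rw [normalMonomial_mul_add hk, normalMonomial_mul_add hp0]
      have e1 : p * (i + 1) + 0 - (p * i + k) = p - k := by omega
      have e2 : i + k + j - i - k = j := by omega
      have e3 : i + k + j - (i + 1) - 0 = j + (k - 1) := by omega
      rw [e1, e2, e3]
      convert Ideal.mul_mem_left _ (X 0 ^ i * X 1 ^ j) (formF_mem_span a b hk1 hk.le) using 1
      simp only [formF, smul_eq_C_mul]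
      ring
  · have hk' : k < p := by omega
    have h0 := hmax (p * i + k) (by rw [hdiv _ _ hk', hmod _ _ hk']; omega) (by omega)
    obtain rfl : e = p * i + k := by omega
    obtain ⟨j, rfl⟩ := Nat.exists_eq_add_of_le hm
    rw [normalMonomial_mul_add hk, normalMonomial_mul_add hk']
    have e1 : p * i + (k + 1) - (p * i + k) = 1 := by omega
    have e2 : i + (k + 1) + j - i - k = j + 1 := by omega
    have e3 : i + (k + 1) + j - i - (k + 1) = j := by omega
    rw [e1, e2, e3]
    convert Ideal.mul_mem_left _ (-(X 0 ^ i * X 1 ^ j * X 2 ^ k)) (formG_mem_span a b p) using 1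
    simp only [formG, smul_eq_C_mul, pow_one]
    ring

theorem MvPolynomial.IsHomogeneous.mem_span_formFamily {a b : R} (ha : IsLeftRegular a)
    (hb : IsLeftRegular b) (hab : ∀ c, b ∣ a * c → b ∣ c) {p : ℕ} (hp : 2 ≤ p) {n : ℕ}
    {F : MvPolynomial (Fin 3) R} (hF : F.IsHomogeneous n)
    (h0 : eval ![a ^ p, b ^ p, a * b ^ (p - 1)] F = 0) :
    F ∈ Ideal.span (Set.range (formFamily a b p)) := by
  set K := Ideal.span (Set.range (formFamily a b p)) with hK
  have hp0 : 0 < p := by omega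
  -- The exponents of normal monomials: the condition says that the exponent of `X₂` is not
  -- negative. It already forces `e ≤ p * n`; the range only supplies finiteness.
  set E := (Finset.range (p * n + 1)).filter (fun e => e / p + e % p ≤ n) with hE
  have memE : ∀ e, e ∈ E ↔ e / p + e % p ≤ n := by
    intro e
    rw [hE, Finset.mem_filter, Finset.mem_range]
    refine ⟨fun h => h.2, fun h => ⟨?_, h⟩⟩
    have h1 : p * (e / p + e % p) ≤ p * n := Nat.mul_le_mul_left p h
    have h2 := Nat.div_add_mod e p
    have h3 : e % p ≤ p * (e % p) := Nat.le_mul_of_pos_left _ hp0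
    rw [mul_add] at h1
    omega
  let ex : (Fin 3 →₀ ℕ) → ℕ := fun d => p * d 0 + d 2
  have hdeg : ∀ d ∈ F.support, d 0 + d 1 + d 2 = n := by
    intro d hd
    have : d.degree = n := by
      rw [Finsupp.degree_eq_weight_one]
      exact hF (mem_support_iff.1 hd)
    rw [Finsupp.degree_eq_sum, Fin.sum_univ_three] at this
    exact this
  have hex : ∀ d ∈ F.support, ex d ∈ E := by
    intro d hd
    rw [memE]
    show (p * d 0 + d 2) / p + (p * d 0 + d 2) % p ≤ n
    rw [Nat.mul_add_div hp0, Nat.mul_add_mod, ← hdeg d hd]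
    have h2 := Nat.div_add_mod (d 2) p
    have h3 : d 2 / p ≤ p * (d 2 / p) := Nat.le_mul_of_pos_left _ hp0
    omega
  -- Monomials with the same value are collected; `hdiff` below shows that this changes `F` only
  -- modulo `K`.
  let c : ℕ → R := fun e => ∑ d ∈ F.support with ex d = e, coeff d F
  have hmon : ∀ d, monomial d (coeff d F) = coeff d F •
      (X 0 ^ d 0 * X 1 ^ d 1 * X 2 ^ d 2 : MvPolynomial (Fin 3) R) := by
    intro d
    rw [monomial_eq, smul_eq_C_mul, Finsupp.prod_fintype _ _ (by simp), Fin.prod_univ_three]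
  have hsum : ∑ e ∈ E, c e * (a ^ e * b ^ (p * n - e)) = 0 := by
    rw [← h0]
    conv_rhs => rw [F.as_sum, map_sum]
    rw [← Finset.sum_fiberwise_of_maps_to hex]
    refine Finset.sum_congr rfl fun e he => ?_
    rw [Finset.sum_mul]
    refine Finset.sum_congr rfl fun d hd => ?_
    rw [Finset.mem_filter] at hd
    obtain ⟨hd, rfl⟩ := hd
    rw [hmon]
    simp only [smul_eval, map_mul, map_pow, eval_X, Matrix.cons_val]
    obtain ⟨q, rfl⟩ := Nat.exists_eq_add_of_le' hp0
    have h1 : (q + 1) * n - ex d = (q + 1) * d 1 + q * d 2 := by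
      show (q + 1) * n - ((q + 1) * d 0 + d 2) = _
      rw [← hdeg d hd, Nat.sub_eq_iff_eq_add (by nlinarith)]
      ring
    rw [h1]
    show _ * (a ^ ((q + 1) * d 0 + d 2) * _) = _
    simp only [Nat.add_sub_cancel]
    ring
  have key := sum_smul_mem_of_sum_mul_pow_eq_zero ha hb hab (K.restrictScalars R)
    (normalMonomial R p n) (p * n) E
    (fun e he => by
      have := Finset.mem_range.1 (Finset.mem_filter.1 he).1
      omega)
    (fun m hm e he hlt hmax => normalMonomial_relation_mem a b hp ((memE e).1 he) ((memE m).1 hm)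
      hlt (fun e' he' => hmax e' ((memE e').2 he'))) c hsum
  have hdiff : F - ∑ e ∈ E, c e • normalMonomial R p n e ∈ K := by
    have : F - ∑ e ∈ E, c e • normalMonomial R p n e =
        ∑ d ∈ F.support, C (coeff d F) * (X 0 ^ d 0 * X 1 ^ d 1 * X 2 ^ d 2 -
          normalMonomial R p n (ex d)) := by
      simp only [mul_sub, Finset.sum_sub_distrib]
      congr 1
      · conv_lhs => rw [F.as_sum]
        exact Finset.sum_congr rfl fun d _ => by rw [hmon, smul_eq_C_mul]
      · rw [← Finset.sum_fiberwise_of_maps_to hex]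
        refine Finset.sum_congr rfl fun e he => ?_
        rw [Finset.sum_smul]
        refine Finset.sum_congr rfl fun d hd => ?_
        rw [(Finset.mem_filter.1 hd).2, smul_eq_C_mul]
    rw [this]
    refine K.sum_mem fun d hd => K.mul_mem_left _ ?_
    have := monomial_sub_normalMonomial_mem a b (p := p) (by omega) (d 0) (d 1) (d 2)
    rwa [hdeg d hd] at this
  have := K.add_mem hdiff key
  rwa [sub_add_cancel] at this

theorem reesEquations_eq_span_formFamily {a b : R} (ha : IsLeftRegular a)
    (hb : IsLeftRegular b) (hab : ∀ c, b ∣ a * c → b ∣ c) {p : ℕ} (hp : 2 ≤ p) :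
    reesEquations ![a ^ p, b ^ p, a * b ^ (p - 1)] =
      Ideal.span (Set.range (formFamily a b p)) := by
  refine le_antisymm (reesEquations_le_of_homogeneous _ _ fun n F hF h0 =>
    hF.mem_span_formFamily ha hb hab hp h0) ?_
  rw [span_formFamily, sup_le_iff, Ideal.span_le, Ideal.span_le, Set.singleton_subset_iff]
  refine ⟨((formG_isHomogeneous a b).mem_reesEquations_iff _).2 (eval_formG a b (by omega)), ?_⟩
  rintro _ ⟨n, h1, h2, rfl⟩
  exact ((formF_isHomogeneous a b p h1).mem_reesEquations_iff _).2 (eval_formF a b h1 h2)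

theorem reesEquations_eq_upTo {a b : R} (ha : IsLeftRegular a)
    (hb : IsLeftRegular b) (hab : ∀ c, b ∣ a * c → b ∣ c) {p : ℕ} (hp : 2 ≤ p) :
    reesEquations ![a ^ p, b ^ p, a * b ^ (p - 1)] =
      reesEquationsUpTo ![a ^ p, b ^ p, a * b ^ (p - 1)] p := by
  refine le_antisymm ?_ (reesEquationsUpTo_le _ p)
  rw [reesEquations_eq_span_formFamily ha hb hab hp, span_formFamily, sup_le_iff, Ideal.span_le,
    Ideal.span_le, Set.singleton_subset_iff]
  refine ⟨Ideal.subset_span ⟨((formG_isHomogeneous a b).mem_reesEquations_iff _).2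
    (eval_formG a b (by omega)), 1, by omega, formG_isHomogeneous a b⟩, ?_⟩
  rintro _ ⟨n, h1, h2, rfl⟩
  exact Ideal.subset_span ⟨((formF_isHomogeneous a b p h1).mem_reesEquations_iff _).2
    (eval_formF a b h1 h2), n, h2, formF_isHomogeneous a b p h1⟩

end Forms

/-! ### Minimality, relation type and reduction number. -/

section Minimality

open MvPolynomial

variable {R : Type*} [CommRing R]

theorem Polynomial.coeff_mem_of_mem_map_C_sup_span_X_pow {B : Ideal R} {n : ℕ} {f : Polynomial R}
    (hf : f ∈ B.map Polynomial.C ⊔ Ideal.span {Polynomial.X ^ n}) {j : ℕ} (hj : j < n) :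
    f.coeff j ∈ B := by
  obtain ⟨u, hu, v, hv, rfl⟩ := Submodule.mem_sup.1 hf
  obtain ⟨w, rfl⟩ := Ideal.mem_span_singleton.1 hv
  rw [Polynomial.coeff_add, Polynomial.coeff_X_pow_mul', if_neg (by omega), add_zero]
  exact Ideal.mem_map_C_iff.1 hu j

/-- The specialization `X₁ ↦ 0`, `X₂ ↦ 0`, `Y ↦ X`. -/
noncomputable def specializeY (R : Type*) [CommRing R] :
    MvPolynomial (Fin 3) R →ₐ[R] Polynomial R :=
  aeval fun i => Polynomial.monomial 1 ((![0, 0, 1] : Fin 3 → R) i)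

theorem specializeY_formG (a b : R) :
    specializeY R (formG a b) = Polynomial.C b * Polynomial.X := by
  simp [specializeY, formG, ← Polynomial.C_mul_X_pow_eq_monomial]

theorem specializeY_formF (a b : R) (p n : ℕ) :
    specializeY R (formF a b p n) = Polynomial.C (a ^ (p - n)) * Polynomial.X ^ n := by
  simp [specializeY, formF, ← Polynomial.C_mul_X_pow_eq_monomial]

theorem coeff_specializeY_mem {a b : R} {p : ℕ} {P : MvPolynomial (Fin 3) R}
    (hP : P ∈ Ideal.span (Set.range (formFamily a b p))) {j : ℕ} (hj : j < p) :
    (specializeY R P).coeff j ∈ Ideal.span {a, b} := by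
  have ha : a ∈ Ideal.span {a, b} := Ideal.subset_span (by simp)
  have hb : b ∈ Ideal.span {a, b} := Ideal.subset_span (by simp)
  refine Polynomial.coeff_mem_of_mem_map_C_sup_span_X_pow (n := p) ?_ hj
  suffices h : Ideal.span (Set.range (formFamily a b p)) ≤
      ((Ideal.span {a, b}).map Polynomial.C ⊔ Ideal.span {Polynomial.X ^ p}).comap
        (specializeY R) from h hP
  rw [span_formFamily, sup_le_iff, Ideal.span_le, Ideal.span_le, Set.singleton_subset_iff]
  constructor
  · rw [SetLike.mem_coe, Ideal.mem_comap, specializeY_formG]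
    exact Ideal.mem_sup_left (Ideal.mul_mem_right _ _ (Ideal.mem_map_of_mem _ hb))
  · rintro _ ⟨n, h1, h2, rfl⟩
    rw [SetLike.mem_coe, Ideal.mem_comap, specializeY_formF]
    rcases h2.lt_or_eq with h2 | rfl
    · exact Ideal.mem_sup_left (Ideal.mul_mem_right _ _ (Ideal.mem_map_of_mem _
        (Ideal.pow_mem_of_mem _ ha _ (by omega))))
    · exact Ideal.mem_sup_right (Ideal.mul_mem_left _ _ (Ideal.mem_span_singleton_self _))

/-- Equations of degree below `p` have all their pure powers of `Y` with coefficient in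
`(a, b)`. -/
theorem MvPolynomial.IsHomogeneous.eval_mem_span_pair {a b : R} {p : ℕ}
    {P : MvPolynomial (Fin 3) R} (hP : P ∈ Ideal.span (Set.range (formFamily a b p))) {d : ℕ}
    (hPd : P.IsHomogeneous d) (hd : d < p) : eval ![0, 0, 1] P ∈ Ideal.span {a, b} := by
  have := coeff_specializeY_mem hP hd
  rwa [specializeY, coeff_aeval_monomial_one, homogeneousComponent_of_mem hPd, if_pos rfl] at this

theorem reesEquations_ne_upTo {a b : R} (ha : IsLeftRegular a)
    (hb : IsLeftRegular b) (hab : ∀ c, b ∣ a * c → b ∣ c) (htop : Ideal.span {a, b} ≠ ⊤) {p : ℕ}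
    (hp : 2 ≤ p) {k : ℕ} (hk : k < p) :
    reesEquations ![a ^ p, b ^ p, a * b ^ (p - 1)] ≠
      reesEquationsUpTo ![a ^ p, b ^ p, a * b ^ (p - 1)] k := by
  intro h
  -- Equations of degree below `p` specialize to polynomials with coefficients in `(a, b)`, whereas
  -- `Fₚ` specializes to `X ^ p`.
  have hle : reesEquationsUpTo ![a ^ p, b ^ p, a * b ^ (p - 1)] k ≤
      ((Ideal.span {a, b}).map Polynomial.C).comap (specializeY R) := by
    refine Ideal.span_le.2 ?_
    rintro P ⟨hP, d, hd, hPd⟩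
    rw [reesEquations_eq_span_formFamily ha hb hab hp] at hP
    refine Ideal.mem_map_C_iff.2 fun j => ?_
    show (specializeY R P).coeff j ∈ _
    rw [specializeY, coeff_aeval_monomial_one, homogeneousComponent_of_mem hPd]
    split_ifs
    · exact hPd.eval_mem_span_pair hP (by omega)
    · simp
  rw [← h, reesEquations_eq_span_formFamily ha hb hab hp] at hle
  have := Ideal.mem_map_C_iff.1 (hle (formF_mem_span a b (by omega : 1 ≤ p) le_rfl)) p
  rw [specializeY_formF] at this
  exact htop ((Ideal.eq_top_iff_one _).2 (by simpa using this))

/-- After specialization, the coefficient of `X ^ n` sees only `b` and, from the `F_j` with `j < n`,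
multiples of `a ^ (p - n + 1)`. Then `a ^ (p - n)` would lie in `(b, a ^ (p - n + 1))`, making `1 -
v * a` a multiple of `b` for some `v`. -/
theorem formF_notMem_span [IsLocalRing R] {a b : R} (ha : a ∈ IsLocalRing.maximalIdeal R)
    (hb : b ∈ IsLocalRing.maximalIdeal R) (hreg : IsLeftRegular b)
    (hab : ∀ c, b ∣ a * c → b ∣ c) {p n : ℕ} (hn : n ≤ p) :
    formF a b p n ∉ Ideal.span {formG a b} ⊔
      Ideal.span {F | ∃ j, 1 ≤ j ∧ j ≤ p ∧ j ≠ n ∧ F = formF a b p j} := by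
  intro h
  have hle : Ideal.span {formG a b} ⊔
      Ideal.span {F | ∃ j, 1 ≤ j ∧ j ≤ p ∧ j ≠ n ∧ F = formF a b p j} ≤
      ((Ideal.span {b, a ^ (p - n + 1)}).map Polynomial.C ⊔
        Ideal.span {Polynomial.X ^ (n + 1)}).comap (specializeY R) := by
    rw [sup_le_iff, Ideal.span_le, Ideal.span_le, Set.singleton_subset_iff]
    constructor
    · rw [SetLike.mem_coe, Ideal.mem_comap, specializeY_formG]
      exact Ideal.mem_sup_left (Ideal.mul_mem_right _ _ (Ideal.mem_map_of_mem _
        (Ideal.subset_span (by simp))))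
    · rintro _ ⟨j, h1, h2, h3, rfl⟩
      rw [SetLike.mem_coe, Ideal.mem_comap, specializeY_formF]
      rcases h3.lt_or_gt with h3 | h3
      · refine Ideal.mem_sup_left (Ideal.mul_mem_right _ _ (Ideal.mem_map_of_mem _ ?_))
        exact Ideal.mem_of_dvd _ (pow_dvd_pow a (by omega : p - n + 1 ≤ p - j))
          (Ideal.subset_span (by simp))
      · exact Ideal.mem_sup_right (Ideal.mem_of_dvd _
          (dvd_mul_of_dvd_right (pow_dvd_pow _ h3) _) (Ideal.mem_span_singleton_self _))
  have hc := Polynomial.coeff_mem_of_mem_map_C_sup_span_X_pow (hle h) (Nat.lt_succ_self n)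
  rw [specializeY_formF, Polynomial.coeff_C_mul_X_pow,
    if_pos rfl] at hc
  obtain ⟨u, v, huv⟩ := Ideal.mem_span_pair.1 hc
  have h1 : b ∣ 1 - v * a := by
    have := pow_dvd_of_pow_dvd_mul hreg hab (p - n) 1 (1 - v * a)
    rw [pow_one] at this
    exact this ⟨u, by linear_combination -huv⟩
  have h2 := Ideal.add_mem _ (Ideal.mem_of_dvd _ h1 hb) (Ideal.mul_mem_left _ v ha)
  rw [sub_add_cancel] at h2
  exact (Ideal.ne_top_iff_one _).1 (IsLocalRing.maximalIdeal.isMaximal R).ne_top h2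

/-- Setting `X₁ = Y = 0` kills every `F_j` but sends `G₁` to `-a X₂`. -/
theorem formG_notMem_span {a : R} (b : R) (ha : a ≠ 0) (p : ℕ) :
    formG a b ∉ Ideal.span {F | ∃ j, 1 ≤ j ∧ j ≤ p ∧ F = formF a b p j} := by
  intro h
  have hle : Ideal.span {F | ∃ j, 1 ≤ j ∧ j ≤ p ∧ F = formF a b p j} ≤
      RingHom.ker (eval₂Hom Polynomial.C ![0, Polynomial.X, 0]) := by
    refine Ideal.span_le.2 ?_
    rintro _ ⟨j, h1, -, rfl⟩
    simp [formF, show j ≠ 0 by omega]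
  have := hle h
  rw [RingHom.mem_ker] at this
  have := congrArg (fun f => Polynomial.coeff f 1) this
  simp [formG] at this
  exact ha this

theorem isMinimalGeneratingFamily_formFamily [IsLocalRing R] {a b : R}
    (ha : a ∈ IsLocalRing.maximalIdeal R) (hb : b ∈ IsLocalRing.maximalIdeal R)
    (hra : IsLeftRegular a) (hrb : IsLeftRegular b) (hab : ∀ c, b ∣ a * c → b ∣ c) {p : ℕ}
    (hp : 2 ≤ p) :
    IsMinimalGeneratingFamily (formFamily a b p)
      (reesEquations ![a ^ p, b ^ p, a * b ^ (p - 1)]) := by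
  rw [reesEquations_eq_span_formFamily hra hrb hab hp]
  refine ⟨rfl, fun i h => ?_⟩
  have hi : formFamily a b p i ∈ Ideal.span (formFamily a b p '' {j | j ≠ i}) :=
    h.symm.le (Ideal.subset_span ⟨i, rfl⟩)
  induction i using Fin.cases with
  | zero =>
    refine formG_notMem_span b hra.ne_zero p (Ideal.span_mono ?_ hi)
    rintro _ ⟨j, hj, rfl⟩
    induction j using Fin.cases with
    | zero => exact absurd rfl hj
    | succ j => exact ⟨j + 1, by omega, j.2, rfl⟩
  | succ i =>
    refine formF_notMem_span ha hb hrb hab (p := p) (n := i + 1) i.2 ?_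
    rw [← Ideal.span_union]
    refine Ideal.span_mono ?_ hi
    rintro _ ⟨j, hj, rfl⟩
    induction j using Fin.cases with
    | zero => exact Or.inl rfl
    | succ j =>
      exact Or.inr ⟨j + 1, by omega, j.2, fun h => hj (congrArg Fin.succ (Fin.ext (by omega))), rfl⟩

theorem isMinimalGeneratingFamily_powers [IsLocalRing R] {a b : R}
    (ha : a ∈ IsLocalRing.maximalIdeal R) (hb : b ∈ IsLocalRing.maximalIdeal R)
    (hra : IsLeftRegular a) (hrb : IsLeftRegular b) (hab : ∀ c, b ∣ a * c → b ∣ c)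
    (hba : ∀ c, a ∣ b * c → a ∣ c) {p : ℕ} (hp : 2 ≤ p) :
    IsMinimalGeneratingFamily ![a ^ p, b ^ p, a * b ^ (p - 1)]
      (Ideal.span {a ^ p, b ^ p, a * b ^ (p - 1)}) := by
  have hone : (1 : R) ∉ IsLocalRing.maximalIdeal R :=
    (Ideal.ne_top_iff_one _).1 (IsLocalRing.maximalIdeal.isMaximal R).ne_top
  have hset : Set.range ![a ^ p, b ^ p, a * b ^ (p - 1)] = {a ^ p, b ^ p, a * b ^ (p - 1)} := by
    rw [Matrix.range_cons, Matrix.range_cons, Matrix.range_cons, Matrix.range_empty,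
      Set.union_empty]
    rfl
  obtain ⟨q, rfl⟩ : ∃ q, p = q + 2 := ⟨p - 2, by omega⟩
  have hq : q + 2 - 1 = q + 1 := rfl
  rw [hq] at hset ⊢
  refine ⟨by rw [hset], fun i h => ?_⟩
  have hi : ![a ^ (q + 2), b ^ (q + 2), a * b ^ (q + 1)] i ∈
      Ideal.span (![a ^ (q + 2), b ^ (q + 2), a * b ^ (q + 1)] '' {j | j ≠ i}) :=
    h.symm.le (Ideal.subset_span (hset ▸ ⟨i, rfl⟩))
  have hle : ∀ s : Set R, (∀ j, j ≠ i → ![a ^ (q + 2), b ^ (q + 2), a * b ^ (q + 1)] j ∈ s) →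
      ![a ^ (q + 2), b ^ (q + 2), a * b ^ (q + 1)] i ∈ Ideal.span s := fun s hs =>
    Ideal.span_mono (by rintro _ ⟨j, hj, rfl⟩; exact hs j hj) hi
  fin_cases i
  · have h1 := hle {b ^ (q + 2), a * b ^ (q + 1)} (fun j hj => by fin_cases j <;> simp at hj ⊢)
    obtain ⟨u, v, huv⟩ := Ideal.mem_span_pair.1 h1
    have h2 := pow_dvd_of_pow_dvd_mul hrb hab (q + 2) 1 1
      ⟨u * b ^ (q + 1) + v * a * b ^ q, by
        simp only [Fin.zero_eta, Matrix.cons_val_zero] at huv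
        linear_combination -huv⟩
    rw [pow_one] at h2
    exact hone (Ideal.mem_of_dvd _ h2 hb)
  · have h1 := hle {a ^ (q + 2), a * b ^ (q + 1)} (fun j hj => by fin_cases j <;> simp at hj ⊢)
    obtain ⟨u, v, huv⟩ := Ideal.mem_span_pair.1 h1
    have h2 := pow_dvd_of_pow_dvd_mul hra hba (q + 2) 1 1
      ⟨u * a ^ (q + 1) + v * b ^ (q + 1), by
        simp only [Fin.mk_one, Matrix.cons_val_one, Matrix.cons_val_zero] at huv
        linear_combination -huv⟩
    rw [pow_one] at h2
    exact hone (Ideal.mem_of_dvd _ h2 ha)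
  · have h1 := hle {a ^ (q + 2), b ^ (q + 2)} (fun j hj => by fin_cases j <;> simp at hj ⊢)
    obtain ⟨u, v, huv⟩ := Ideal.mem_span_pair.1 h1
    simp only [Fin.reduceFinMk, Matrix.cons_val] at huv
    -- From `y = u x₁ + v x₂`, cancelling `a` modulo `b ^ (q + 2)` and then `b ^ (q + 1)` puts 1 in
    -- the maximal ideal.
    obtain ⟨w, hw⟩ := pow_dvd_of_pow_dvd_mul hrb hab 1 (q + 2) (b ^ (q + 1) - u * a ^ (q + 1))
      ⟨v, by linear_combination -huv⟩
    obtain ⟨t, rfl⟩ := pow_dvd_of_pow_dvd_mul hrb hab (q + 1) (q + 1) u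
      ⟨1 - b * w, by linear_combination -hw⟩
    have h2 : 1 = b * w + t * a ^ (q + 1) := (hrb.pow (q + 1)) (by
      show b ^ (q + 1) * 1 = b ^ (q + 1) * (b * w + t * a ^ (q + 1))
      linear_combination hw)
    refine hone (h2 ▸ Ideal.add_mem _ (Ideal.mul_mem_right _ _ hb) (Ideal.mul_mem_left _ _ ?_))
    exact Ideal.pow_mem_of_mem _ ha _ (by omega)

/-- Among products of `n + 1` generators, only `y ^ (n + 1)` has no factor from `J`. -/
theorem Ideal.sup_span_singleton_pow_le (J : Ideal R) (y : R) (n : ℕ) :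
    (J ⊔ Ideal.span {y}) ^ (n + 1) ≤
      J * (J ⊔ Ideal.span {y}) ^ n ⊔ Ideal.span {y ^ (n + 1)} := by
  induction n with
  | zero => simp
  | succ n ih =>
    rw [pow_succ _ (n + 1)]
    refine (Ideal.mul_mono_left ih).trans ?_
    rw [Ideal.sup_mul, mul_assoc, ← pow_succ]
    refine sup_le le_sup_left ?_
    rw [Ideal.mul_sup]
    refine sup_le (le_sup_of_le_left ?_) (le_sup_of_le_right ?_)
    · rw [mul_comm]
      refine Ideal.mul_mono_right ?_
      rw [← Ideal.span_singleton_pow]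
      exact Ideal.pow_right_mono le_sup_right _
    · rw [Ideal.span_singleton_mul_span_singleton, ← pow_succ]

theorem isReductionNumber_powers {a b : R}
    (hra : IsLeftRegular a) (hrb : IsLeftRegular b) (hab : ∀ c, b ∣ a * c → b ∣ c)
    (htop : Ideal.span {a, b} ≠ ⊤) {p : ℕ} (hp : 2 ≤ p) :
    IsReductionNumber (Ideal.span {a ^ p, b ^ p})
      (Ideal.span {a ^ p, b ^ p, a * b ^ (p - 1)}) (p - 1) := by
  have hset : Set.range ![a ^ p, b ^ p, a * b ^ (p - 1)] = {a ^ p, b ^ p, a * b ^ (p - 1)} := by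
    rw [Matrix.range_cons, Matrix.range_cons, Matrix.range_cons, Matrix.range_empty,
      Set.union_empty]
    rfl
  have hJI : Ideal.span {a ^ p, b ^ p} ≤ Ideal.span {a ^ p, b ^ p, a * b ^ (p - 1)} :=
    Ideal.span_mono (by rintro x (rfl | rfl) <;> simp)
  refine ⟨hJI, le_antisymm ?_ ?_, fun k hk => ?_⟩
  · have hI : Ideal.span {a ^ p, b ^ p, a * b ^ (p - 1)} =
        Ideal.span {a ^ p, b ^ p} ⊔ Ideal.span {a * b ^ (p - 1)} := by
      rw [← Ideal.span_union]
      congr 1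
      ext x
      simp only [Set.mem_insert_iff, Set.mem_singleton_iff, Set.mem_union, or_assoc]
    rw [hI]
    refine (Ideal.sup_span_singleton_pow_le _ _ _).trans (sup_le le_rfl ?_)
    rw [← hI, Ideal.span_singleton_le_iff_mem]
    have : (a * b ^ (p - 1)) ^ (p - 1 + 1) = a ^ p * (b ^ p) ^ (p - 1) := by
      rw [Nat.sub_add_cancel (by omega : 1 ≤ p)]
      ring
    rw [this]
    exact Ideal.mul_mem_mul (Ideal.subset_span (by simp))
      (Ideal.pow_mem_pow (Ideal.subset_span (by simp)) _)
  · rw [pow_succ']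
    exact Ideal.mul_mono_left hJI
  · by_contra hlt
    have hy : (a * b ^ (p - 1)) ^ (k + 1) ∈
        Ideal.span {a ^ p, b ^ p} * Ideal.span {a ^ p, b ^ p, a * b ^ (p - 1)} ^ k := by
      rw [← show _ = _ from hk]
      exact Ideal.pow_mem_pow (Ideal.subset_span (by simp)) _
    rw [Ideal.span_insert, Ideal.sup_mul] at hy
    obtain ⟨s, hs, t, ht, hst⟩ := Submodule.mem_sup.1 hy
    obtain ⟨u, hu, rfl⟩ := Ideal.mem_span_singleton_mul.1 hs
    obtain ⟨v, hv, rfl⟩ := Ideal.mem_span_singleton_mul.1 ht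
    rw [← hset, Ideal.mem_span_pow_iff_exists_isHomogeneous] at hu hv
    obtain ⟨U, hU, rfl⟩ := hu
    obtain ⟨V, hV, rfl⟩ := hv
    -- Membership of `y ^ (k + 1)` in `J * I ^ k` becomes an equation whose pure `Y`-coefficient is
    -- 1, impossible in degree below `p`.
    have hP : (X 2 ^ (k + 1) - X 0 * U - X 1 * V : MvPolynomial (Fin 3) R).IsHomogeneous
        (k + 1) := by
      refine ((isHomogeneous_X_pow 2 (k + 1)).sub ?_).sub ?_
      · rw [add_comm]; exact (isHomogeneous_X R 0).mul hU
      · rw [add_comm]; exact (isHomogeneous_X R 1).mul hV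
    have h0 := hP.mem_span_formFamily hra hrb hab hp (by
      simp only [map_sub, map_mul, map_pow, eval_X, Matrix.cons_val]
      rw [← hst]
      ring)
    have := hP.eval_mem_span_pair h0 (by omega)
    simp only [map_sub, map_mul, map_pow, eval_X, Matrix.cons_val, one_pow, zero_mul,
      sub_zero] at this
    exact htop ((Ideal.eq_top_iff_one _).2 this)

end Minimality

theorem mainTheorem5 {R : Type*} [CommRing R] [IsLocalRing R] [IsNoetherianRing R]
    (a₁ a₂ : R) (ha : RingTheory.Sequence.IsRegular R [a₁, a₂])
    (p : ℕ) (hp : 2 ≤ p)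
    (x₁ x₂ y : R) (hx₁ : x₁ = a₁ ^ p) (hx₂ : x₂ = a₂ ^ p) (hy : y = a₁ * a₂ ^ (p - 1))
    (I J : Ideal R) (hI : I = Ideal.span {x₁, x₂, y}) (hJ : J = Ideal.span {x₁, x₂}) :
    IsMinimalGeneratingFamily ![x₁, x₂, y] I ∧
    (formG a₁ a₂).IsHomogeneous 1 ∧
    (∀ n : ℕ, 1 ≤ n → n ≤ p → (formF a₁ a₂ p n).IsHomogeneous n) ∧
    IsMinimalGeneratingFamily (formFamily a₁ a₂ p) (reesEquations ![x₁, x₂, y]) ∧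
    ∃ r : ℕ, IsReductionNumber J I r ∧ IsRelationType I (r + 1) ∧ r + 1 = p := by
  subst hx₁ hx₂ hy hI hJ
  -- Regular sequences may be permuted over a Noetherian local ring; the syzygy argument needs `a₂`
  -- regular and `a₁` regular modulo `a₂`.
  have hswap : RingTheory.Sequence.IsRegular R [a₂, a₁] :=
    IsLocalRing.isRegular_of_perm ha (List.Perm.swap _ _ _)
  have hra := ha.toIsWeaklyRegular.isLeftRegular_head
  have hrb := hswap.toIsWeaklyRegular.isLeftRegular_head
  have hab : ∀ c, a₂ ∣ a₁ * c → a₂ ∣ c := fun c => hswap.toIsWeaklyRegular.dvd_of_dvd_mul_pair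
  have hba : ∀ c, a₁ ∣ a₂ * c → a₁ ∣ c := fun c => ha.toIsWeaklyRegular.dvd_of_dvd_mul_pair
  have htop : Ideal.span {a₁, a₂} ≠ ⊤ := by
    intro h
    refine ha.top_ne_smul ?_
    have : Ideal.ofList [a₁, a₂] = Ideal.span {a₁, a₂} := by
      rw [Ideal.ofList]
      congr 1
      ext x
      simp
    rw [this, h, Submodule.top_smul]
  have hm := IsLocalRing.le_maximalIdeal htop
  have ham : a₁ ∈ IsLocalRing.maximalIdeal R := hm (Ideal.subset_span (by simp))
  have hbm : a₂ ∈ IsLocalRing.maximalIdeal R := hm (Ideal.subset_span (by simp))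
  have hmin := isMinimalGeneratingFamily_powers ham hbm hra hrb hab hba hp
  refine ⟨hmin, formG_isHomogeneous _ _, fun n hn _ => formF_isHomogeneous _ _ _ hn,
    isMinimalGeneratingFamily_formFamily ham hbm hra hrb hab hp, p - 1,
    isReductionNumber_powers hra hrb hab htop hp, ?_, by omega⟩
  have hspan : Ideal.span (Set.range ![a₁ ^ p, a₂ ^ p, a₁ * a₂ ^ (p - 1)]) =
    Ideal.span {a₁ ^ p, a₂ ^ p, a₁ * a₂ ^ (p - 1)} := hmin.1
  rw [← hspan, Nat.sub_add_cancel (by omega : 1 ≤ p)]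
  refine isRelationType_span_range _ _
    ⟨⟨by omega, reesEquations_eq_upTo hra hrb hab hp⟩, fun k hk => ?_⟩
  by_contra hlt
  exact reesEquations_ne_upTo hra hrb hab htop hp (not_le.1 hlt) hk.2
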